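/- Let $I\subseteq\mathbb{R}$ be a nonempty open interval and let $f:I\to\mathbb{R}$ be strictly increasing. Let $f^{(-1)}:\operatorname{conv}(f(I))\to I$ denote the generalized inverse of $f$, i.e. the unique increasing function with $f^{(-1)}(f(x))=x$ for all $x\in I$. For an integer $n\ge 1$ put $\Lambda_n:=[0,\infty)^n\setminus\{(0,\dots,0)\}$ and, for $x\in I^n$ and $\lambda\in\Lambda_n$, $$A_f^{[n]}(x):=f^{(-1)}\Big(\frac{f(x_1)+\dots+f(x_n)}{n}\Big),\qquad \widetilde A_f^{[n]}(x;\lambda):=f^{(-1)}\Big(\frac{\lambda_1f(x_1)+\dots+\lambda_nf(x_n)}{\lambda_1+\dots+\lambda_n}\Big).$$ Then the following conditions are equivalent. (a) For all integers $n\ge 1$ and all $x,y\in I^n$, $$A_f^{[n]}\Big(\frac{x_1+y_1}2,\dots,\frac{x_n+y_n}2\Big)\le \frac12\big(A_f^{[n]}(x)+A_f^{[n]}(y)\big).$$ (b) For all integers $n\ge 1$, all $x,y\in I^n$ and all $\lambda\in\Lambda_n$, $$\widetilde A_f^{[n]}\Big(\frac{x_1+y_1}2,\dots,\frac{x_n+y_n}2;\lambda\Big)\le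 \frac12\big(\widetilde A_f^{[n]}(x;\lambda)+\widetilde A_f^{[n]}(y;\lambda)\big).$$ (c) For all $x,y\in I^2$, $$A_f^{[2]}\Big(\frac{x_1+y_1}2,\frac{x_2+y_2}2\Big)\le \frac12\big(A_f^{[2]}(x)+A_f^{[2]}(y)\big).$$ (d) The function $f$ is continuous and the function $\Psi:f(I)^2\to\mathbb{R}$ defined by $\Psi(u,v):=f\Big(\dfrac{f^{-1}(u)+f^{-1}(v)}2\Big)$ is concave. (e) The function $f$ is twice continuously differentiable on $I$ with $f'>0$ on $I$, and either $f''=0$ everywhere on $I$, or $f''>0$ everywhere on $I$ and $\dfrac{f'}{f''}$ is concave on $I$. -/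

import Mathlib

namespace QuasiArith

/-- The generalized inverse of a strictly increasing function `f` on the interval `I`:
the unique increasing left inverse of `f` from the convex hull of `f '' I` to `I`
(see `genInv_spec` and `genInv_unique`). Values outside that convex hull are irrelevant. -/
noncomputable def genInv (I : Set ℝ) (f : ℝ → ℝ) (u : ℝ) : ℝ :=
  sSup {x | x ∈ I ∧ f x ≤ u}

/-- The `n`-variable generalized quasi-arithmetic mean generated by `f` on `I`. -/
noncomputable def genMean (I : Set ℝ) (f : ℝ → ℝ) {n : ℕ} (x : Fin n → ℝ) : ℝ :=
  genInv I f ((∑ i, f (x i)) / (n : ℝ))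

/-- The set `[0, ∞)ⁿ \ {0}` of admissible weights. -/
def weights (n : ℕ) : Set (Fin n → ℝ) :=
  {w | (∀ i, 0 ≤ w i) ∧ w ≠ 0}

/-- The `n`-variable weighted generalized quasi-arithmetic mean generated by `f` on `I`. -/
noncomputable def genWMean (I : Set ℝ) (f : ℝ → ℝ) {n : ℕ} (x w : Fin n → ℝ) : ℝ :=
  genInv I f ((∑ i, w i * f (x i)) / ∑ i, w i)

/-- Every point of the convex hull of `f '' I` lies between two values of `f`. -/
theorem exists_bounds {I : Set ℝ} {f : ℝ → ℝ} {u : ℝ} (hu : u ∈ convexHull ℝ (f '' I)) :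
    ∃ a ∈ I, ∃ b ∈ I, f a ≤ u ∧ u ≤ f b := by
  have hsub : convexHull ℝ (f '' I) ⊆ {v | ∃ a ∈ I, ∃ b ∈ I, f a ≤ v ∧ v ≤ f b} := by
    refine convexHull_min ?_ ?_
    · rintro _ ⟨a, ha, rfl⟩
      exact ⟨a, ha, a, ha, le_rfl, le_rfl⟩
    · refine Set.OrdConnected.convex ⟨?_⟩
      rintro v ⟨a, ha, -, -, hav, -⟩ v' ⟨-, -, b, hb, -, hvb⟩ w ⟨hw, hw'⟩
      exact ⟨a, ha, b, hb, hav.trans hw, hw'.trans hvb⟩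
  exact hsub hu

theorem bddAbove_of_le {I : Set ℝ} {f : ℝ → ℝ} (hf : StrictMonoOn f I) {u b : ℝ} (hb : b ∈ I)
    (hub : u ≤ f b) : b ∈ upperBounds {x | x ∈ I ∧ f x ≤ u} :=
  fun _ hx => (hf.le_iff_le hx.1 hb).1 (hx.2.trans hub)

/-- The generalized inverse maps the convex hull of `f '' I` to `I`, is increasing there, and is a
left inverse of `f` on `I`. -/
theorem genInv_spec {I : Set ℝ} (hI : I.OrdConnected) {f : ℝ → ℝ} (hf : StrictMonoOn f I) :
    Set.MapsTo (genInv I f) (convexHull ℝ (f '' I)) I ∧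
      MonotoneOn (genInv I f) (convexHull ℝ (f '' I)) ∧ Set.LeftInvOn (genInv I f) f I := by
  refine ⟨fun u hu => ?_, fun u hu v hv huv => ?_, fun x hx => ?_⟩
  · obtain ⟨a, ha, b, hb, hau, hub⟩ := exists_bounds hu
    exact hI.out ha hb ⟨le_csSup ⟨b, bddAbove_of_le hf hb hub⟩ ⟨ha, hau⟩,
      csSup_le ⟨a, ha, hau⟩ (bddAbove_of_le hf hb hub)⟩
  · obtain ⟨a, ha, -, -, hau, -⟩ := exists_bounds hu
    obtain ⟨-, -, b, hb, -, hvb⟩ := exists_bounds hv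
    exact csSup_le_csSup ⟨b, bddAbove_of_le hf hb hvb⟩ ⟨a, ha, hau⟩
      fun x hx => ⟨hx.1, hx.2.trans huv⟩
  · exact IsGreatest.csSup_eq ⟨⟨hx, le_rfl⟩, bddAbove_of_le hf hx le_rfl⟩

/-- Uniqueness of the generalized inverse. -/
theorem genInv_unique {I : Set ℝ} (hI : I.OrdConnected) {f : ℝ → ℝ} (hf : StrictMonoOn f I)
    {g : ℝ → ℝ} (hg : Set.MapsTo g (convexHull ℝ (f '' I)) I)
    (hmono : MonotoneOn g (convexHull ℝ (f '' I))) (hinv : Set.LeftInvOn g f I) :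
    Set.EqOn g (genInv I f) (convexHull ℝ (f '' I)) := by
  have hmem : ∀ {x}, x ∈ I → f x ∈ convexHull ℝ (f '' I) :=
    fun hx => subset_convexHull ℝ _ ⟨_, hx, rfl⟩
  obtain ⟨h1, h2, h3⟩ := genInv_spec hI hf
  have key : ∀ {p q : ℝ → ℝ}, Set.MapsTo p (convexHull ℝ (f '' I)) I →
      MonotoneOn p (convexHull ℝ (f '' I)) → Set.LeftInvOn p f I →
      Set.MapsTo q (convexHull ℝ (f '' I)) I → MonotoneOn q (convexHull ℝ (f '' I)) →
      Set.LeftInvOn q f I → ∀ u ∈ convexHull ℝ (f '' I), p u ≤ q u := by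
    intro p q hp hpm hpi hq hqm hqi u hu
    by_contra! hlt
    obtain ⟨c, hc1, hc2⟩ := exists_between hlt
    have hc : c ∈ I := hI.out (hq hu) (hp hu) ⟨hc1.le, hc2.le⟩
    rcases le_total u (f c) with h | h
    · have := hpm hu (hmem hc) h
      rw [hpi hc] at this
      linarith
    · have := hqm (hmem hc) hu h
      rw [hqi hc] at this
      linarith
  exact fun u hu => le_antisymm (key hg hmono hinv h1 h2 h3 u hu)
    (key h1 h2 h3 hg hmono hinv u hu)

end QuasiArith

open Set Filter Topology

namespace QuasiArith

/-! Write Ψ for `midTransport I f`. Applying f turns the two-variable Jensen inequality into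
midpoint concavity of Ψ, and the finite Jensen inequality for concave Ψ returns the weighted
inequality for every n. Only continuity of f has to be supplied: at a jump p, the mean of any two
points close to p on opposite sides equals p, which contradicts Jensen convexity
(`continuousOn_of_jensen`).

Smoothness is extracted from concavity of Ψ in stages. Symmetry of Ψ makes f convex. Concave
sections of Ψ order the one-sided derivatives of f opposite to convexity, so f is differentiable
(`differentiableAt_of_concaveOn_midTransport`). The tangent inequality for Ψ makes a ↦ (f x - f a) /
f' a convex for every x. Differences of these are multiples of 1 / f', and comparing f x on both
sides of f a shows that 1 / f' is differentiable, with continuous derivative.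

For twice differentiable f with f' > 0, concavity of Ψ is a quadratic inequality in two velocities
P, Q. It forces f'' ≥ 0, and a zero of f'' spreads over I by connectedness. If f'' > 0, the optimal
P, Q turn it into concavity of f' / f'', and Cauchy-Schwarz gives the converse. -/

/-! ### Midpoint convexity and derivatives of convex functions -/

/-- A continuous function on a convex set that is convex at midpoints is convex. -/
theorem convexOn_of_midpoint {E : Type*} [NormedAddCommGroup E] [NormedSpace ℝ E] {s : Set E}
    {g : E → ℝ} (hs : Convex ℝ s) (hg : ContinuousOn g s)
    (hmid : ∀ x ∈ s, ∀ y ∈ s, g ((1 / 2 : ℝ) • (x + y)) ≤ (g x + g y) / 2) :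
    ConvexOn ℝ s g := by
  refine ⟨hs, fun x hx y hy a b ha hb hab => ?_⟩
  set ℓ : ℝ → E := fun t => (1 - t) • x + t • y with hℓ
  have hℓs : ∀ t ∈ Icc (0 : ℝ) 1, ℓ t ∈ s := fun t ht =>
    hs hx hy (by linarith [ht.2]) ht.1 (by ring)
  set k : ℝ → ℝ := fun t => g (ℓ t) - ((1 - t) * g x + t * g y) with hk
  have hkc : ContinuousOn k (Icc 0 1) := by
    refine ContinuousOn.sub (hg.comp ?_ hℓs) ?_
    · exact Continuous.continuousOn (by fun_prop)
    · exact Continuous.continuousOn (by fun_prop)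
  have hkm : ∀ t ∈ Icc (0 : ℝ) 1, ∀ u ∈ Icc (0 : ℝ) 1, k ((t + u) / 2) ≤ (k t + k u) / 2 := by
    intro t ht u hu
    have h := hmid _ (hℓs t ht) _ (hℓs u hu)
    have e : (1 / 2 : ℝ) • (ℓ t + ℓ u) = ℓ ((t + u) / 2) := by
      simp only [hℓ]; module
    rw [e] at h
    simp only [hk]
    linarith
  have k0 : k 0 = 0 := by simp [hk, hℓ]
  have k1 : k 1 = 0 := by simp [hk, hℓ]
  obtain ⟨t, ht, hmax⟩ := isCompact_Icc.exists_isMaxOn ⟨0, left_mem_Icc.2 zero_le_one⟩ hkc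
  -- The maximum point t is the midpoint of 2t and 0, or of 2t - 1 and 1, and k vanishes at both
  -- endpoints. Hence k t ≤ k t / 2.
  have hM : k t ≤ 0 := by
    rcases le_total t (1 / 2) with h | h
    · have hu : 2 * t ∈ Icc (0 : ℝ) 1 := ⟨by linarith [ht.1], by linarith⟩
      have h1 := hkm 0 (by simp) _ hu
      have h2 : k (2 * t) ≤ k t := hmax hu
      rw [show (0 + 2 * t) / 2 = t by ring] at h1
      linarith
    · have hu : 2 * t - 1 ∈ Icc (0 : ℝ) 1 := ⟨by linarith, by linarith [ht.2]⟩
      have h1 := hkm 1 (by simp) _ hu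
      have h2 : k (2 * t - 1) ≤ k t := hmax hu
      rw [show (1 + (2 * t - 1)) / 2 = t by ring] at h1
      linarith
  have hbI : b ∈ Icc (0 : ℝ) 1 := ⟨hb, by linarith⟩
  have hb' : k b ≤ k t := hmax hbI
  have ea : a = 1 - b := by linarith
  have : g (ℓ b) ≤ (1 - b) * g x + b * g y := by simp only [hk] at hb' hM; linarith
  simpa [hℓ, ea] using this

theorem concaveOn_of_midpoint {E : Type*} [NormedAddCommGroup E] [NormedSpace ℝ E] {s : Set E}
    {g : E → ℝ} (hs : Convex ℝ s) (hg : ContinuousOn g s)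
    (hmid : ∀ x ∈ s, ∀ y ∈ s, (g x + g y) / 2 ≤ g ((1 / 2 : ℝ) • (x + y))) :
    ConcaveOn ℝ s g := by
  refine neg_convexOn_iff.1 (convexOn_of_midpoint hs hg.neg fun x hx y hy => ?_)
  have := hmid x hx y hy
  simp only [Pi.neg_apply]
  linarith

/-- The derivative of a differentiable convex function on an open set is continuous. -/
theorem continuousAt_deriv_of_convexOn {S : Set ℝ} (hS : IsOpen S) {g g' : ℝ → ℝ}
    (hg : ConvexOn ℝ S g) (hd : ∀ x ∈ S, HasDerivAt g (g' x) x) {x : ℝ} (hx : x ∈ S) :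
    ContinuousAt g' x := by
  have hcont : ContinuousAt g x := (hd x hx).continuousAt
  have hslope := hasDerivAt_iff_tendsto_slope.1 (hd x hx)
  have hsl : ∀ b, b ≠ x → Tendsto (fun a => slope g a b) (𝓝 x) (𝓝 (slope g x b)) := by
    intro b hb
    simp only [slope_def_field]
    exact (tendsto_const_nhds.sub hcont).div (tendsto_const_nhds.sub tendsto_id)
      (sub_ne_zero.2 hb)
  -- By convexity, g' a is bounded below by the secant slope from a fixed b < x and above by that to
  -- a fixed b > x. These slopes are continuous in a, and b can be taken so close to x that they
  -- approximate g' x.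
  refine tendsto_order.2 ⟨fun c hc => ?_, fun c hc => ?_⟩
  · have h1 : ∀ᶠ b in 𝓝[<] x, c < slope g x b :=
      (hslope.mono_left (nhdsWithin_mono _ fun b (hb : b < x) => hb.ne)).eventually
        (lt_mem_nhds hc)
    have h2 : ∀ᶠ b in 𝓝[<] x, b ∈ S := mem_nhdsWithin_of_mem_nhds (hS.mem_nhds hx)
    obtain ⟨b, hb, hbS, hbx⟩ := (h1.and (h2.and self_mem_nhdsWithin)).exists
    filter_upwards [(hsl b (ne_of_lt hbx)).eventually (lt_mem_nhds hb), hS.mem_nhds hx,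
      lt_mem_nhds hbx] with a h1 h2 h3
    rw [slope_comm] at h1
    exact h1.trans_le (hg.slope_le_of_hasDerivAt hbS h2 h3 (hd a h2))
  · have h1 : ∀ᶠ b in 𝓝[>] x, slope g x b < c :=
      (hslope.mono_left (nhdsWithin_mono _ fun b (hb : x < b) => hb.ne')).eventually
        (gt_mem_nhds hc)
    have h2 : ∀ᶠ b in 𝓝[>] x, b ∈ S := mem_nhdsWithin_of_mem_nhds (hS.mem_nhds hx)
    obtain ⟨b, hb, hbS, hbx⟩ := (h1.and (h2.and self_mem_nhdsWithin)).exists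
    filter_upwards [(hsl b (ne_of_gt hbx)).eventually (gt_mem_nhds hb), hS.mem_nhds hx,
      gt_mem_nhds hbx] with a h1 h2 h3
    exact (hg.le_slope_of_hasDerivAt h2 hbS h3 (hd a h2)).trans_lt h1

/-! ### Inverses of strictly increasing functions -/

section inverse

variable {I : Set ℝ} {f : ℝ → ℝ}

theorem invFunOn_apply (hf : StrictMonoOn f I) {x : ℝ} (hx : x ∈ I) :
    Function.invFunOn f I (f x) = x :=
  hf.injOn.leftInvOn_invFunOn hx

theorem invFunOn_mem {u : ℝ} (hu : u ∈ f '' I) : Function.invFunOn f I u ∈ I :=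
  Function.invFunOn_mem hu

theorem apply_invFunOn {u : ℝ} (hu : u ∈ f '' I) : f (Function.invFunOn f I u) = u :=
  Function.invFunOn_eq hu

theorem half_add_mem (hIc : I.OrdConnected) {x y : ℝ} (hx : x ∈ I) (hy : y ∈ I) :
    (x + y) / 2 ∈ I := by
  rcases le_total x y with h | h
  · exact hIc.out hx hy ⟨by linarith, by linarith⟩
  · exact hIc.out hy hx ⟨by linarith, by linarith⟩

theorem convex_image (hIc : I.OrdConnected) (hfc : ContinuousOn f I) : Convex ℝ (f '' I) :=
  ((hIc.isPreconnected).image f hfc).ordConnected.convex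

theorem isOpen_image (hIo : IsOpen I) (hIc : I.OrdConnected) (hf : StrictMonoOn f I)
    (hfc : ContinuousOn f I) : IsOpen (f '' I) := by
  rw [isOpen_iff_mem_nhds]
  rintro _ ⟨p, hp, rfl⟩
  obtain ⟨a, b, ⟨hap, hpb⟩, hab⟩ := mem_nhds_iff_exists_Ioo_subset.1 (hIo.mem_nhds hp)
  have ha : (a + p) / 2 ∈ I := hab ⟨by linarith, by linarith⟩
  have hb : (p + b) / 2 ∈ I := hab ⟨by linarith, by linarith⟩
  have h1 : f ((a + p) / 2) < f p := hf ha hp (by linarith)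
  have h2 : f p < f ((p + b) / 2) := hf hp hb (by linarith)
  refine mem_of_superset (Icc_mem_nhds h1 h2) ?_
  exact (convex_image hIc hfc).ordConnected.out (mem_image_of_mem _ ha) (mem_image_of_mem _ hb)

theorem strictMonoOn_invFunOn (hf : StrictMonoOn f I) :
    StrictMonoOn (Function.invFunOn f I) (f '' I) := by
  rintro _ ⟨x, hx, rfl⟩ _ ⟨y, hy, rfl⟩ h
  rw [invFunOn_apply hf hx, invFunOn_apply hf hy]
  exact (hf.lt_iff_lt hx hy).1 h

theorem continuousAt_invFunOn (hIo : IsOpen I) (hIc : I.OrdConnected) (hf : StrictMonoOn f I)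
    (hfc : ContinuousOn f I) {u : ℝ} (hu : u ∈ f '' I) :
    ContinuousAt (Function.invFunOn f I) u := by
  refine (strictMonoOn_invFunOn hf).continuousAt_of_image_mem_nhds
    ((isOpen_image hIo hIc hf hfc).mem_nhds hu) ?_
  rw [(hf.injOn.leftInvOn_invFunOn).image_image]
  exact hIo.mem_nhds (invFunOn_mem hu)

theorem hasDerivAt_invFunOn (hIo : IsOpen I) (hIc : I.OrdConnected) (hf : StrictMonoOn f I)
    (hfc : ContinuousOn f I) {u d : ℝ} (hu : u ∈ f '' I) (hd : d ≠ 0)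
    (h : HasDerivAt f d (Function.invFunOn f I u)) :
    HasDerivAt (Function.invFunOn f I) d⁻¹ u := by
  refine HasDerivAt.of_local_left_inverse (continuousAt_invFunOn hIo hIc hf hfc hu) h hd ?_
  filter_upwards [(isOpen_image hIo hIc hf hfc).mem_nhds hu] with y hy using apply_invFunOn hy

theorem genInv_apply (hIc : I.OrdConnected) (hf : StrictMonoOn f I) {x : ℝ} (hx : x ∈ I) :
    genInv I f (f x) = x :=
  (genInv_spec hIc hf).2.2 hx

theorem genInv_mem (hIc : I.OrdConnected) (hf : StrictMonoOn f I) {u : ℝ} (hu : u ∈ f '' I) :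
    genInv I f u ∈ I := by
  obtain ⟨x, hx, rfl⟩ := hu
  rwa [genInv_apply hIc hf hx]

theorem apply_genInv (hIc : I.OrdConnected) (hf : StrictMonoOn f I) {u : ℝ} (hu : u ∈ f '' I) :
    f (genInv I f u) = u := by
  obtain ⟨x, hx, rfl⟩ := hu
  rw [genInv_apply hIc hf hx]

end inverse

/-! ### Jensen convexity of the mean and concavity of Ψ -/

section continuity

variable {I : Set ℝ} {f : ℝ → ℝ}

/-- A strictly increasing function whose generalized two-variable quasi-arithmetic mean is
Jensen convex is continuous. -/
theorem continuousOn_of_jensen (hIo : IsOpen I) (hIc : I.OrdConnected) (hf : StrictMonoOn f I)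
    (h : ∀ x₁ ∈ I, ∀ x₂ ∈ I, ∀ y₁ ∈ I, ∀ y₂ ∈ I,
      genInv I f ((f ((x₁ + y₁) / 2) + f ((x₂ + y₂) / 2)) / 2) ≤
        (genInv I f ((f x₁ + f x₂) / 2) + genInv I f ((f y₁ + f y₂) / 2)) / 2) :
    ContinuousOn f I := by
  intro p hp
  refine ContinuousAt.continuousWithinAt ?_
  obtain ⟨a, b, ⟨hap, hpb⟩, hab⟩ := mem_nhds_iff_exists_Ioo_subset.1 (hIo.mem_nhds hp)
  have hne₁ : (f '' (I ∩ Iio p)).Nonempty :=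
    ⟨_, mem_image_of_mem f (⟨hab ⟨by linarith, by linarith⟩, show (a + p) / 2 < p by linarith⟩ :
      (a + p) / 2 ∈ I ∩ Iio p)⟩
  have hne₂ : (f '' (I ∩ Ioi p)).Nonempty :=
    ⟨_, mem_image_of_mem f (⟨hab ⟨by linarith, by linarith⟩, show p < (p + b) / 2 by linarith⟩ :
      (p + b) / 2 ∈ I ∩ Ioi p)⟩
  have hub : f p ∈ upperBounds (f '' (I ∩ Iio p)) := by
    rintro _ ⟨x, ⟨hx, hxp⟩, rfl⟩
    exact (hf hx hp hxp).le
  have hlb : f p ∈ lowerBounds (f '' (I ∩ Ioi p)) := by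
    rintro _ ⟨x, ⟨hx, hxp⟩, rfl⟩
    exact (hf hp hx hxp).le
  set L := sSup (f '' (I ∩ Iio p)) with hL
  set R := sInf (f '' (I ∩ Ioi p)) with hR
  have hLp : L ≤ f p := csSup_le hne₁ hub
  have hRp : f p ≤ R := le_csInf hne₂ hlb
  have hleL : ∀ x ∈ I, x < p → f x ≤ L := fun x hx hxp =>
    le_csSup ⟨_, hub⟩ (mem_image_of_mem f ⟨hx, hxp⟩)
  have hRle : ∀ x ∈ I, p < x → R ≤ f x := fun x hx hxp =>
    csInf_le ⟨_, hlb⟩ (mem_image_of_mem f ⟨hx, hxp⟩)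
  have hRL : R ≤ L := by
    by_contra! hlt
    -- The values f x₀ and f y₀ lie within the jump size R - L of L and R. So for x in [x₀, p) and y
    -- in (p, y₀] the average of f x and f y falls strictly between L and R, where the generalized
    -- inverse is p.
    obtain ⟨_, ⟨x₀, ⟨hx₀, hx₀p⟩, rfl⟩, hx₀L⟩ :=
      exists_lt_of_lt_csSup hne₁ (show L - (R - L) < L by linarith)
    obtain ⟨_, ⟨y₀, ⟨hy₀, hy₀p⟩, rfl⟩, hy₀R⟩ :=
      exists_lt_of_csInf_lt hne₂ (show R < R + (R - L) by linarith)
    simp only [mem_Iio, mem_Ioi] at hx₀p hy₀p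
    have key : ∀ x y, x₀ ≤ x → x < p → p < y → y ≤ y₀ →
        x ∈ I ∧ y ∈ I ∧ genInv I f ((f x + f y) / 2) = p := by
      intro x y h1 h2 h3 h4
      have hx : x ∈ I := hIc.out hx₀ hp ⟨h1, h2.le⟩
      have hy : y ∈ I := hIc.out hp hy₀ ⟨h3.le, h4⟩
      refine ⟨hx, hy, ?_⟩
      have e1 : f x₀ ≤ f x := hf.monotoneOn hx₀ hx h1
      have e2 : f y ≤ f y₀ := hf.monotoneOn hy hy₀ h4
      have e3 := hleL x hx h2
      have e4 := hRle y hy h3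
      have hub' : p ∈ upperBounds {z | z ∈ I ∧ f z ≤ (f x + f y) / 2} := by
        rintro z ⟨hz, hzu⟩
        by_contra! hpz
        linarith [hRle z hz hpz]
      refine le_antisymm (csSup_le ⟨x, hx, by linarith⟩ hub') ?_
      refine le_of_forall_lt fun c hc => ?_
      have hm : max x ((c + p) / 2) < p := max_lt h2 (by linarith)
      have hmI : max x ((c + p) / 2) ∈ I := hIc.out hx hp ⟨le_max_left _ _, hm.le⟩
      have hle : max x ((c + p) / 2) ≤ genInv I f ((f x + f y) / 2) :=
        le_csSup ⟨p, hub'⟩ ⟨hmI, by linarith [hleL _ hmI hm]⟩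
      have := le_max_right x ((c + p) / 2)
      linarith
    obtain ⟨δ, hδ, hδ1, hδ2⟩ : ∃ δ > 0, δ ≤ p - x₀ ∧ δ ≤ y₀ - p :=
      ⟨min (p - x₀) (y₀ - p), lt_min (by linarith) (by linarith), min_le_left _ _,
        min_le_right _ _⟩
    -- Jensen is applied to the pairs (p - δ/2, p - δ/2) and (p - δ/2, p + δ), with means p - δ/2
    -- and p. Their midpoint (p - δ/2, p + δ/4) still straddles p, so its mean is p, exceeding p -
    -- δ/4.
    obtain ⟨hQ1, hQ2, hQ⟩ := key (p - δ / 2) (p + δ) (by linarith) (by linarith) (by linarith)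
      (by linarith)
    obtain ⟨-, -, hM⟩ := key (p - δ / 2) (p + δ / 4) (by linarith) (by linarith) (by linarith)
      (by linarith)
    have := h _ hQ1 _ hQ1 _ hQ1 _ hQ2
    rw [hQ, add_self_div_two (f (p - δ / 2)), genInv_apply hIc hf hQ1, add_self_div_two,
      show (p - δ / 2 + (p + δ)) / 2 = p + δ / 4 by ring, hM] at this
    linarith
  have hLe : L = f p := by linarith
  have hRe : R = f p := by linarith
  refine hf.continuousAt_of_exists_between (hIo.mem_nhds hp) (fun c hc => ?_) fun c hc => ?_
  · rw [← hLe] at hc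
    obtain ⟨_, ⟨x, ⟨hx, hxp⟩, rfl⟩, hxL⟩ := exists_lt_of_lt_csSup hne₁ hc
    exact ⟨x, hx, hxL.le, hf hx hp hxp⟩
  · rw [← hRe] at hc
    obtain ⟨_, ⟨x, ⟨hx, hxp⟩, rfl⟩, hxL⟩ := exists_lt_of_csInf_lt hne₂ hc
    exact ⟨x, hx, hf hp hx hxp, hxL.le⟩

/-- The function `(u, v) ↦ f ((f⁻¹ u + f⁻¹ v) / 2)`. -/
noncomputable def midTransport (I : Set ℝ) (f : ℝ → ℝ) (p : ℝ × ℝ) : ℝ :=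
  f ((Function.invFunOn f I p.1 + Function.invFunOn f I p.2) / 2)

theorem midTransport_apply (hf : StrictMonoOn f I) {x y : ℝ} (hx : x ∈ I) (hy : y ∈ I) :
    midTransport I f (f x, f y) = f ((x + y) / 2) := by
  simp [midTransport, invFunOn_apply hf hx, invFunOn_apply hf hy]

theorem continuousOn_midTransport (hIo : IsOpen I) (hIc : I.OrdConnected)
    (hf : StrictMonoOn f I) (hfc : ContinuousOn f I) :
    ContinuousOn (midTransport I f) ((f '' I) ×ˢ (f '' I)) := by
  have hφ : ContinuousOn (Function.invFunOn f I) (f '' I) := fun u hu =>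
    (continuousAt_invFunOn hIo hIc hf hfc hu).continuousWithinAt
  refine hfc.comp (ContinuousOn.div_const (ContinuousOn.add
    (hφ.comp continuousOn_fst fun p hp => hp.1) (hφ.comp continuousOn_snd fun p hp => hp.2)) 2) ?_
  exact fun p hp => half_add_mem hIc (invFunOn_mem hp.1) (invFunOn_mem hp.2)

/-- Applying the increasing f to both sides of the Jensen inequality gives midpoint concavity of Ψ
at (f x₁, f y₁) and (f x₂, f y₂); continuity then upgrades it. -/
theorem concaveOn_midTransport_of_jensen (hIo : IsOpen I) (hIc : I.OrdConnected)
    (hf : StrictMonoOn f I) (hfc : ContinuousOn f I)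
    (h : ∀ x₁ ∈ I, ∀ x₂ ∈ I, ∀ y₁ ∈ I, ∀ y₂ ∈ I,
      genInv I f ((f ((x₁ + y₁) / 2) + f ((x₂ + y₂) / 2)) / 2) ≤
        (genInv I f ((f x₁ + f x₂) / 2) + genInv I f ((f y₁ + f y₂) / 2)) / 2) :
    ConcaveOn ℝ ((f '' I) ×ˢ (f '' I)) (midTransport I f) := by
  have hJ := convex_image hIc hfc
  refine concaveOn_of_midpoint (hJ.prod hJ) (continuousOn_midTransport hIo hIc hf hfc) ?_
  have hmid : ∀ x ∈ I, ∀ y ∈ I, (f x + f y) / 2 ∈ f '' I := fun x hx y hy =>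
    half_add_mem hJ.ordConnected (mem_image_of_mem f hx) (mem_image_of_mem f hy)
  rintro ⟨_, _⟩ ⟨⟨x₁, hx₁, rfl⟩, ⟨y₁, hy₁, rfl⟩⟩ ⟨_, _⟩ ⟨⟨x₂, hx₂, rfl⟩, ⟨y₂, hy₂, rfl⟩⟩
  have hX := hmid _ hx₁ _ hx₂
  have hY := hmid _ hy₁ _ hy₂
  have e : (1 / 2 : ℝ) • ((f x₁, f y₁) + (f x₂, f y₂)) = (f (genInv I f ((f x₁ + f x₂) / 2)),
      f (genInv I f ((f y₁ + f y₂) / 2))) := by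
    rw [apply_genInv hIc hf hX, apply_genInv hIc hf hY]
    ext <;> simp <;> ring
  have hM := hmid _ (half_add_mem hIc hx₁ hy₁) _ (half_add_mem hIc hx₂ hy₂)
  rw [e, midTransport_apply hf hx₁ hy₁, midTransport_apply hf hx₂ hy₂,
    midTransport_apply hf (genInv_mem hIc hf hX) (genInv_mem hIc hf hY), ← apply_genInv hIc hf hM]
  exact hf.monotoneOn (genInv_mem hIc hf hM)
    (half_add_mem hIc (genInv_mem hIc hf hX) (genInv_mem hIc hf hY)) (h _ hx₁ _ hx₂ _ hy₁ _ hy₂)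

/-- This is the finite Jensen inequality for Ψ at the points (f (x i), f (y i)) with normalized
weights, pulled back through f. -/
theorem genWMean_jensen_of_concaveOn (hIc : I.OrdConnected)
    (hf : StrictMonoOn f I) (hfc : ContinuousOn f I)
    (hΨ : ConcaveOn ℝ ((f '' I) ×ˢ (f '' I)) (midTransport I f)) {n : ℕ} {x y : Fin n → ℝ}
    (hx : ∀ i, x i ∈ I) (hy : ∀ i, y i ∈ I) {w : Fin n → ℝ} (hw : w ∈ weights n) :
    genWMean I f (fun i => (x i + y i) / 2) w ≤
      (1 / 2 : ℝ) * (genWMean I f x w + genWMean I f y w) := by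
  have hJ := convex_image hIc hfc
  have hpos : 0 < ∑ i, w i := by
    refine (Finset.sum_nonneg fun i _ => hw.1 i).lt_of_ne' fun h0 => hw.2 ?_
    funext i
    exact (Finset.sum_eq_zero_iff_of_nonneg fun i _ => hw.1 i).1 h0 i (Finset.mem_univ i)
  set W := ∑ i, w i with hW
  have h0 : ∀ i ∈ Finset.univ, 0 ≤ w i / W := fun i _ => div_nonneg (hw.1 i) hpos.le
  have h1 : ∑ i, w i / W = 1 := by rw [← Finset.sum_div, div_self hpos.ne']
  have hs : ∀ z : Fin n → ℝ, (∑ i, w i * z i) / W = ∑ i, (w i / W) • z i := fun z => by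
    rw [Finset.sum_div]
    exact Finset.sum_congr rfl fun i _ => by rw [smul_eq_mul]; ring
  have hmem : ∀ z : Fin n → ℝ, (∀ i, z i ∈ I) → (∑ i, w i * f (z i)) / W ∈ f '' I := by
    intro z hz
    rw [hs fun i => f (z i)]
    exact hJ.sum_mem h0 h1 fun i _ => mem_image_of_mem f (hz i)
  have hm : ∀ i, (x i + y i) / 2 ∈ I := fun i => half_add_mem hIc (hx i) (hy i)
  have hX := genInv_mem hIc hf (hmem x hx)
  have hY := genInv_mem hIc hf (hmem y hy)
  have key := hΨ.le_map_sum h0 h1 (p := fun i => (f (x i), f (y i)))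
    fun i _ => ⟨mem_image_of_mem f (hx i), mem_image_of_mem f (hy i)⟩
  have e : ∑ i, (w i / W) • (f (x i), f (y i)) =
      (f (genInv I f ((∑ i, w i * f (x i)) / W)), f (genInv I f ((∑ i, w i * f (y i)) / W))) := by
    rw [apply_genInv hIc hf (hmem x hx), apply_genInv hIc hf (hmem y hy), hs, hs]
    ext
    · simp [Prod.fst_sum]
    · simp [Prod.snd_sum]
  rw [e, midTransport_apply hf hX hY] at key
  simp only [midTransport_apply hf (hx _) (hy _)] at key
  rw [← hs fun i => f ((x i + y i) / 2), ← apply_genInv hIc hf (hmem _ hm)] at key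
  have := (hf.le_iff_le (genInv_mem hIc hf (hmem _ hm)) (half_add_mem hIc hX hY)).1 key
  simp only [genWMean, ← hW]
  linarith

end continuity

/-! ### Concavity of Ψ along lines: first- and second-order conditions -/

variable {I : Set ℝ} {f f' f'' : ℝ → ℝ}

/-- The derivative of `midTransport I f` along the line `t ↦ (u + t p, v + t q)`. -/
noncomputable def lineDeriv (I : Set ℝ) (f f' : ℝ → ℝ) (u v p q t : ℝ) : ℝ :=
  f' ((Function.invFunOn f I (u + t * p) + Function.invFunOn f I (v + t * q)) / 2) *
    ((p / f' (Function.invFunOn f I (u + t * p)) + q / f' (Function.invFunOn f I (v + t * q))) / 2)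

/-- The parameters for which the line `t ↦ (u + t p, v + t q)` runs inside `J × J`. -/
def lineDomain (J : Set ℝ) (u v p q : ℝ) : Set ℝ :=
  {t | u + t * p ∈ J ∧ v + t * q ∈ J}

theorem isOpen_lineDomain {J : Set ℝ} (hJ : IsOpen J) (u v p q : ℝ) :
    IsOpen (lineDomain J u v p q) :=
  (hJ.preimage (f := fun t => u + t * p) (by fun_prop)).inter
    (hJ.preimage (f := fun t => v + t * q) (by fun_prop))

theorem convex_lineDomain {J : Set ℝ} (hJ : Convex ℝ J) (u v p q : ℝ) :
    Convex ℝ (lineDomain J u v p q) := by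
  intro s hs t ht a b ha hb hab
  constructor
  · have := hJ hs.1 ht.1 ha hb hab
    convert this using 1
    simp only [smul_eq_mul]
    linear_combination (-u) * hab
  · have := hJ hs.2 ht.2 ha hb hab
    convert this using 1
    simp only [smul_eq_mul]
    linear_combination (-v) * hab

theorem concaveOn_line {J : Set ℝ} {Ψ : ℝ × ℝ → ℝ} (h : ConcaveOn ℝ (J ×ˢ J) Ψ)
    (hJ : Convex ℝ J) (u v p q : ℝ) :
    ConcaveOn ℝ (lineDomain J u v p q) (fun t => Ψ (u + t * p, v + t * q)) := by
  refine ⟨convex_lineDomain hJ u v p q, fun s hs t ht a b ha hb hab => ?_⟩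
  have := h.2 (show (u + s * p, v + s * q) ∈ J ×ˢ J from hs)
    (show (u + t * p, v + t * q) ∈ J ×ˢ J from ht) ha hb hab
  convert this using 2
  ext
  · simp only [Prod.fst_add, Prod.smul_fst, smul_eq_mul]
    linear_combination (-u) * hab
  · simp only [Prod.snd_add, Prod.smul_snd, smul_eq_mul]
    linear_combination (-v) * hab

section derivatives

variable (hIo : IsOpen I) (hIc : I.OrdConnected) (hf : StrictMonoOn f I)
  (hd : ∀ x ∈ I, HasDerivAt f (f' x) x) (hpos : ∀ x ∈ I, 0 < f' x)

include hIo hIc hf hd hpos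

theorem hasDerivAt_invFunOn_line {u p t : ℝ} (hu : u + t * p ∈ f '' I) :
    HasDerivAt (fun t => Function.invFunOn f I (u + t * p))
      (p / f' (Function.invFunOn f I (u + t * p))) t := by
  have hfc : ContinuousOn f I := fun x hx => (hd x hx).continuousAt.continuousWithinAt
  have hm := invFunOn_mem hu
  have h1 := hasDerivAt_invFunOn hIo hIc hf hfc hu (hpos _ hm).ne' (hd _ hm)
  have h2 : HasDerivAt (fun t => u + t * p) p t := by
    simpa using ((hasDerivAt_id t).mul_const p).const_add u
  have := h1.comp t h2
  rwa [inv_mul_eq_div] at this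

theorem hasDerivAt_midTransport_line {u v p q t : ℝ} (ht : t ∈ lineDomain (f '' I) u v p q) :
    HasDerivAt (fun t => midTransport I f (u + t * p, v + t * q)) (lineDeriv I f f' u v p q t)
      t := by
  have h1 := hasDerivAt_invFunOn_line hIo hIc hf hd hpos ht.1
  have h2 := hasDerivAt_invFunOn_line hIo hIc hf hd hpos ht.2
  have hm := half_add_mem hIc (invFunOn_mem ht.1) (invFunOn_mem ht.2)
  exact (hd _ hm).comp t ((h1.add h2).div_const 2)

/-- P and Q are the velocities of the preimages x and y along the line; in these variables the
second derivative is a quadratic form. -/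
theorem hasDerivAt_lineDeriv (hd' : ∀ x ∈ I, HasDerivAt f' (f'' x) x) {u v p q t x y P Q : ℝ}
    (ht : t ∈ lineDomain (f '' I) u v p q) (hx : Function.invFunOn f I (u + t * p) = x)
    (hy : Function.invFunOn f I (v + t * q) = y) (hP : P = p / f' x) (hQ : Q = q / f' y) :
    HasDerivAt (lineDeriv I f f' u v p q)
      (f'' ((x + y) / 2) * ((P + Q) / 2) ^ 2 -
        f' ((x + y) / 2) * (f'' x / f' x * P ^ 2 + f'' y / f' y * Q ^ 2) / 2) t := by
  have h1 := hasDerivAt_invFunOn_line hIo hIc hf hd hpos ht.1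
  have h2 := hasDerivAt_invFunOn_line hIo hIc hf hd hpos ht.2
  have hxI := invFunOn_mem ht.1
  have hyI := invFunOn_mem ht.2
  have hm := half_add_mem hIc hxI hyI
  have hx0 := hpos _ hxI
  have hy0 := hpos _ hyI
  have h3 := (hd' _ hm).comp t ((h1.add h2).div_const 2)
  have h4 := ((hasDerivAt_const t p).div ((hd' _ hxI).comp t h1) hx0.ne')
  have h5 := ((hasDerivAt_const t q).div ((hd' _ hyI).comp t h2) hy0.ne')
  have h6 := h3.mul ((h4.add h5).div_const 2)
  refine h6.congr_deriv ?_
  simp only [Function.comp_apply, Pi.add_apply, Pi.div_apply, hx, hy] at hx0 hy0 ⊢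
  subst hP hQ
  field_simp
  ring

theorem second_order_of_concaveOn (hd' : ∀ x ∈ I, HasDerivAt f' (f'' x) x)
    (hΨ : ConcaveOn ℝ ((f '' I) ×ˢ (f '' I)) (midTransport I f)) {x y : ℝ} (hx : x ∈ I)
    (hy : y ∈ I) (P Q : ℝ) :
    f'' ((x + y) / 2) * ((P + Q) / 2) ^ 2 ≤
      f' ((x + y) / 2) * (f'' x / f' x * P ^ 2 + f'' y / f' y * Q ^ 2) / 2 := by
  have hfc : ContinuousOn f I := fun x hx => (hd x hx).continuousAt.continuousWithinAt
  -- The direction is scaled by f' so that the preimages of the two coordinates start with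
  -- velocities P and Q.
  set T := lineDomain (f '' I) (f x) (f y) (P * f' x) (Q * f' y) with hT
  have h0 : (0 : ℝ) ∈ T := by
    constructor
    · simpa using mem_image_of_mem f hx
    · simpa using mem_image_of_mem f hy
  have hTo : IsOpen T := isOpen_lineDomain (isOpen_image hIo hIc hf hfc) _ _ _ _
  have hg := concaveOn_line hΨ (convex_image hIc hfc) (f x) (f y) (P * f' x) (Q * f' y)
  have hg1 : ∀ t ∈ T, HasDerivAt _ _ t := fun t ht =>
    hasDerivAt_midTransport_line hIo hIc hf hd hpos ht
  have hanti : AntitoneOn (lineDeriv I f f' (f x) (f y) (P * f' x) (Q * f' y)) T :=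
    (hg.antitoneOn_deriv fun t ht => (hg1 t ht).differentiableAt).congr fun t ht =>
      (hg1 t ht).deriv
  have h2 := hasDerivAt_lineDeriv hIo hIc hf hd hpos hd' h0 (x := x) (y := y) (P := P) (Q := Q)
    (by simp [invFunOn_apply hf hx]) (by simp [invFunOn_apply hf hy])
    (mul_div_cancel_right₀ P (hpos x hx).ne').symm (mul_div_cancel_right₀ Q (hpos y hy).ne').symm
  have h3 := hanti.derivWithin_nonpos (x := 0)
  rw [(h2.hasDerivWithinAt (s := T)).derivWithin (hTo.uniqueDiffWithinAt h0)] at h3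
  linarith

theorem concaveOn_of_second_order (hd' : ∀ x ∈ I, HasDerivAt f' (f'' x) x)
    (h : ∀ x ∈ I, ∀ y ∈ I, ∀ P Q : ℝ, f'' ((x + y) / 2) * ((P + Q) / 2) ^ 2 ≤
      f' ((x + y) / 2) * (f'' x / f' x * P ^ 2 + f'' y / f' y * Q ^ 2) / 2) :
    ConcaveOn ℝ ((f '' I) ×ˢ (f '' I)) (midTransport I f) := by
  have hfc : ContinuousOn f I := fun x hx => (hd x hx).continuousAt.continuousWithinAt
  have hJ := convex_image hIc hfc
  refine ⟨hJ.prod hJ, ?_⟩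
  rintro ⟨u, v⟩ ⟨hu, hv⟩ ⟨u', v'⟩ ⟨hu', hv'⟩ a b ha hb hab
  set T := lineDomain (f '' I) u v (u' - u) (v' - v) with hT
  have hTo : IsOpen T := isOpen_lineDomain (isOpen_image hIo hIc hf hfc) _ _ _ _
  have h0 : (0 : ℝ) ∈ T := by constructor <;> simpa
  have h1 : (1 : ℝ) ∈ T := by constructor <;> simpa
  have hg1 : ∀ t ∈ T, HasDerivAt _ _ t := fun t ht =>
    hasDerivAt_midTransport_line hIo hIc hf hd hpos ht
  have hg2 : ∀ t ∈ T, HasDerivAt _ _ t := fun t ht =>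
    hasDerivAt_lineDeriv hIo hIc hf hd hpos hd' ht rfl rfl rfl rfl
  have hconc : ConcaveOn ℝ T
      (fun t => midTransport I f (u + t * (u' - u), v + t * (v' - v))) := by
    refine concaveOn_of_hasDerivWithinAt2_nonpos (convex_lineDomain hJ _ _ _ _)
      (fun t ht => (hg1 t ht).continuousAt.continuousWithinAt)
      (fun t ht => (hg1 t (interior_subset ht)).hasDerivWithinAt)
      (fun t ht => (hg2 t (interior_subset ht)).hasDerivWithinAt) fun t ht => ?_
    have ht' := interior_subset ht
    exact sub_nonpos.2 (h _ (invFunOn_mem ht'.1) _ (invFunOn_mem ht'.2) _ _)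
  have := hconc.2 h0 h1 ha hb hab
  have ea : a = 1 - b := by linarith
  subst ea
  convert this using 2
  · simp
  · simp
  · ext <;> simp <;> ring

/-- The graph of Ψ lies below its tangent plane at (f a, f b). Only first derivatives of f enter, so
this is available before f is known to be twice differentiable. -/
theorem tangent_of_concaveOn
    (hΨ : ConcaveOn ℝ ((f '' I) ×ˢ (f '' I)) (midTransport I f)) {x y a b : ℝ} (hx : x ∈ I)
    (hy : y ∈ I) (ha : a ∈ I) (hb : b ∈ I) :
    (f ((x + y) / 2) - f ((a + b) / 2)) / f' ((a + b) / 2) ≤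
      ((f x - f a) / f' a + (f y - f b) / f' b) / 2 := by
  have hfc : ContinuousOn f I := fun x hx => (hd x hx).continuousAt.continuousWithinAt
  have h0 : (0 : ℝ) ∈ lineDomain (f '' I) (f a) (f b) (f x - f a) (f y - f b) := by
    constructor
    · simpa using mem_image_of_mem f ha
    · simpa using mem_image_of_mem f hb
  have h1 : (1 : ℝ) ∈ lineDomain (f '' I) (f a) (f b) (f x - f a) (f y - f b) := by
    constructor
    · simpa using mem_image_of_mem f hx
    · simpa using mem_image_of_mem f hy
  have hg := concaveOn_line hΨ (convex_image hIc hfc) (f a) (f b) (f x - f a) (f y - f b)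
  have := hg.slope_le_of_hasDerivAt h0 h1 zero_lt_one
    (hasDerivAt_midTransport_line hIo hIc hf hd hpos h0)
  simp only [slope_def_field, lineDeriv, one_mul, zero_mul, add_zero, sub_zero, div_one,
    add_sub_cancel, midTransport_apply hf hx hy, midTransport_apply hf ha hb,
    invFunOn_apply hf ha, invFunOn_apply hf hb] at this
  rw [div_le_iff₀' (hpos _ (half_add_mem hIc ha hb))]
  exact this

end derivatives

/-! ### Regularity of f from concavity of Ψ -/

/-- Ψ is symmetric and Ψ(w, w) = w, so averaging (u, v) with (v, u) gives Ψ(u, v) ≤ (u + v) / 2. -/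
theorem convexOn_of_concaveOn_midTransport (hIc : I.OrdConnected) (hf : StrictMonoOn f I)
    (hfc : ContinuousOn f I) (hΨ : ConcaveOn ℝ ((f '' I) ×ˢ (f '' I)) (midTransport I f)) :
    ConvexOn ℝ I f := by
  refine convexOn_of_midpoint hIc.convex hfc fun x hx y hy => ?_
  have hu : f x ∈ f '' I := mem_image_of_mem f hx
  have hv : f y ∈ f '' I := mem_image_of_mem f hy
  obtain ⟨z, hz, hzm⟩ := half_add_mem (convex_image hIc hfc).ordConnected hu hv
  have h := hΨ.2 (mk_mem_prod hu hv) (mk_mem_prod hv hu) one_half_pos.le one_half_pos.le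
    (add_halves 1)
  have e : (1 / 2 : ℝ) • (f x, f y) + (1 / 2 : ℝ) • (f y, f x) = (f z, f z) := by
    rw [hzm]; ext <;> simp <;> ring
  rw [e, midTransport_apply hf hx hy, midTransport_apply hf hy hx, midTransport_apply hf hz hz,
    add_self_div_two, hzm, add_comm y x] at h
  simp only [smul_eq_mul] at h ⊢
  rw [one_div_mul_eq_div]
  linarith

theorem exists_lt_mem_lt_mem (hIo : IsOpen I) {x : ℝ} (hx : x ∈ I) :
    ∃ a ∈ I, ∃ b ∈ I, a < x ∧ x < b := by
  obtain ⟨a, b, ⟨hax, hxb⟩, hab⟩ := mem_nhds_iff_exists_Ioo_subset.1 (hIo.mem_nhds hx)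
  exact ⟨(a + x) / 2, hab ⟨by linarith, by linarith⟩, (x + b) / 2,
    hab ⟨by linarith, by linarith⟩, by linarith, by linarith⟩

theorem deriv_pos_of_convexOn (hIo : IsOpen I) (hf : StrictMonoOn f I) (hconv : ConvexOn ℝ I f)
    {x d : ℝ} (hx : x ∈ I) (hd : HasDerivAt f d x) : 0 < d := by
  obtain ⟨a, ha, -, -, hax, -⟩ := exists_lt_mem_lt_mem hIo hx
  refine lt_of_lt_of_le ?_ (hconv.slope_le_of_hasDerivAt ha hx hax hd)
  rw [slope_def_field]
  exact div_pos (sub_pos.2 (hf ha hx hax)) (sub_pos.2 hax)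

theorem hasDerivAt_of_left_right {g : ℝ → ℝ} {d x : ℝ} (hl : HasDerivWithinAt g d (Iio x) x)
    (hr : HasDerivWithinAt g d (Ioi x) x) : HasDerivAt g d x := by
  have := (hasDerivWithinAt_Iio_iff_Iic.1 hl).union (hasDerivWithinAt_Ioi_iff_Ici.1 hr)
  rwa [Iic_union_Ici, hasDerivWithinAt_univ] at this

theorem differentiableAt_of_concaveOn_midTransport (hIo : IsOpen I) (hIc : I.OrdConnected)
    (hf : StrictMonoOn f I) (hfc : ContinuousOn f I)
    (hΨ : ConcaveOn ℝ ((f '' I) ×ˢ (f '' I)) (midTransport I f)) {m : ℝ} (hm : m ∈ I) :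
    DifferentiableAt ℝ f m := by
  have hconv := convexOn_of_concaveOn_midTransport hIc hf hfc hΨ
  have hmi : m ∈ interior I := by rwa [hIo.interior_eq]
  have hr := hconv.hasDerivWithinAt_rightDeriv_of_mem_interior hmi
  have hl := hconv.hasDerivWithinAt_leftDeriv_of_mem_interior hmi
  have hlr := hconv.leftDeriv_le_rightDeriv_of_mem_interior hmi
  set r := derivWithin f (Ioi m) m
  set l := derivWithin f (Iio m) m
  suffices hrl : r ≤ l by
    rw [le_antisymm hlr hrl] at hl
    exact (hasDerivAt_of_left_right hl hr).differentiableAt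
  -- A monotone function is differentiable almost everywhere, hence at some x whose reflection 2m -
  -- x also lies in I. A corner of f at m would then appear in the section of Ψ through f (2m - x)
  -- at the point f x.
  obtain ⟨x, ⟨hx, hy⟩, hxd⟩ : ∃ x ∈ {x | x ∈ I ∧ 2 * m - x ∈ I}, x ∈ I →
      DifferentiableWithinAt ℝ f I x := by
    have hU : IsOpen {x | x ∈ I ∧ 2 * m - x ∈ I} :=
      hIo.inter (hIo.preimage (f := fun x => 2 * m - x) (by fun_prop))
    exact (MeasureTheory.Measure.dense_of_ae
      hf.monotoneOn.ae_differentiableWithinAt_of_mem).inter_open_nonempty _ hU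
      ⟨m, hm, by rwa [two_mul, add_sub_cancel_right]⟩
  have hdx := ((hxd hx).differentiableAt (hIo.mem_nhds hx)).hasDerivAt
  have hpos := deriv_pos_of_convexOn hIo hf hconv hx hdx
  set d := deriv f x
  set k : ℝ → ℝ := fun s => f ((s + (2 * m - x)) / 2) with hk
  have hin : HasDerivAt (fun s : ℝ => (s + (2 * m - x)) / 2) (1 / 2) x :=
    ((hasDerivAt_id x).add_const _).div_const 2
  have hxm : (x + (2 * m - x)) / 2 = m := by ring
  have hkr : HasDerivWithinAt k (r * (1 / 2)) (Ioi x) x :=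
    HasDerivWithinAt.comp (s' := Ioi m) x (by rwa [hxm]) hin.hasDerivWithinAt
      fun s (hs : x < s) => by rw [mem_Ioi]; linarith
  have hkl : HasDerivWithinAt k (l * (1 / 2)) (Iio x) x :=
    HasDerivWithinAt.comp (s' := Iio m) x (by rwa [hxm]) hin.hasDerivWithinAt
      fun s (hs : s < x) => by rw [mem_Iio]; linarith
  -- These quotients are secant slopes of the section u ↦ Ψ(u, f (2m - x)), whose concavity makes
  -- them decrease. In the limit r / (2d) ≤ l / (2d).
  have hquot : ∀ s ∈ I, ∀ t ∈ I, s < x → x < t →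
      slope k x t / slope f x t ≤ slope k x s / slope f x s := by
    intro s hs t ht hsx hxt
    have hc := concaveOn_line hΨ (convex_image hIc hfc) 0 (f (2 * m - x)) 1 0
    have hmem : ∀ z ∈ I, f z ∈ lineDomain (f '' I) 0 (f (2 * m - x)) 1 0 := fun z hz =>
      ⟨by simpa using mem_image_of_mem f hz, by simpa using mem_image_of_mem f hy⟩
    have := hc.slope_anti_adjacent (hmem s hs) (hmem t ht) (hf hs hx hsx) (hf hx ht hxt)
    simp only [zero_add, mul_one, mul_zero, add_zero, midTransport_apply hf hs hy,
      midTransport_apply hf hx hy, midTransport_apply hf ht hy] at this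
    rw [slope_comm k x s, slope_comm f x s]
    simp only [slope_def_field]
    rwa [div_div_div_cancel_right₀ (sub_pos.2 hxt).ne', div_div_div_cancel_right₀
      (sub_pos.2 hsx).ne']
  have hlimr : Tendsto (fun t => slope k x t / slope f x t) (𝓝[>] x) (𝓝 (r * (1 / 2) / d)) :=
    ((hasDerivWithinAt_iff_tendsto_slope' self_notMem_Ioi).1 hkr).div
      ((hasDerivWithinAt_iff_tendsto_slope' self_notMem_Ioi).1 hdx.hasDerivWithinAt) hpos.ne'
  have hliml : Tendsto (fun t => slope k x t / slope f x t) (𝓝[<] x) (𝓝 (l * (1 / 2) / d)) :=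
    ((hasDerivWithinAt_iff_tendsto_slope' self_notMem_Iio).1 hkl).div
      ((hasDerivWithinAt_iff_tendsto_slope' self_notMem_Iio).1 hdx.hasDerivWithinAt) hpos.ne'
  have hmemr : ∀ᶠ t in 𝓝[>] x, t ∈ I := mem_nhdsWithin_of_mem_nhds (hIo.mem_nhds hx)
  have hmeml : ∀ᶠ t in 𝓝[<] x, t ∈ I := mem_nhdsWithin_of_mem_nhds (hIo.mem_nhds hx)
  have hfin : r * (1 / 2) / d ≤ l * (1 / 2) / d := by
    refine ge_of_tendsto hliml ?_
    filter_upwards [hmeml, self_mem_nhdsWithin] with s hs hsx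
    refine le_of_tendsto hlimr ?_
    filter_upwards [hmemr, self_mem_nhdsWithin] with t ht hxt using hquot s hs t ht hsx hxt
  rw [div_le_div_iff_of_pos_right hpos] at hfin
  linarith

/-- If all the functions `a ↦ (f x - f a) / f' a` are convex, then `1 / f'` is
differentiable. -/
theorem differentiableAt_inv_of_convexOn (hIo : IsOpen I) (hf : StrictMonoOn f I)
    (hd : ∀ x ∈ I, HasDerivAt f (f' x) x)
    (hE : ∀ x ∈ I, ConvexOn ℝ I fun a => (f x - f a) / f' a) {a : ℝ} (ha : a ∈ I) :
    DifferentiableAt ℝ (fun a => (f' a)⁻¹) a := by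
  obtain ⟨x, hx, y, hy, hxa, hay⟩ := exists_lt_mem_lt_mem hIo ha
  have h1 : f x < f a := hf hx ha hxa
  have h2 : f a < f y := hf ha hy hay
  have hai : a ∈ interior I := by rwa [hIo.interior_eq]
  have hrep : (fun a => (f' a)⁻¹) =
      fun a => ((f y - f a) / f' a - (f x - f a) / f' a) / (f y - f x) := by
    funext b
    rw [← sub_div, sub_sub_sub_cancel_right, div_div_cancel_left' (by linarith)]
  obtain ⟨ρ, hr⟩ : ∃ ρ, HasDerivWithinAt (fun a => (f' a)⁻¹) ρ (Ioi a) a := by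
    rw [hrep]
    exact ⟨_, (((hE y hy).hasDerivWithinAt_rightDeriv_of_mem_interior hai).sub
      ((hE x hx).hasDerivWithinAt_rightDeriv_of_mem_interior hai)).div_const _⟩
  obtain ⟨σ, hl⟩ : ∃ σ, HasDerivWithinAt (fun a => (f' a)⁻¹) σ (Iio a) a := by
    rw [hrep]
    exact ⟨_, (((hE y hy).hasDerivWithinAt_leftDeriv_of_mem_interior hai).sub
      ((hE x hx).hasDerivWithinAt_leftDeriv_of_mem_interior hai)).div_const _⟩
  -- By the product rule, the ordering of the one-sided derivatives of the convex function reduces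
  -- to this inequality. Taking z on either side of a changes the sign of the factor and gives σ =
  -- ρ.
  have key : ∀ z ∈ I, (f z - f a) * σ ≤ (f z - f a) * ρ := by
    intro z hz
    have hle := (hE z hz).leftDeriv_le_rightDeriv_of_mem_interior hai
    have hzd := ((hd a ha).const_sub (f z))
    have e1 : derivWithin (fun a => (f z - f a) / f' a) (Ioi a) a =
        -f' a * (f' a)⁻¹ + (f z - f a) * ρ :=
      (hzd.hasDerivWithinAt.mul hr).derivWithin (uniqueDiffWithinAt_Ioi a)
    have e2 : derivWithin (fun a => (f z - f a) / f' a) (Iio a) a =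
        -f' a * (f' a)⁻¹ + (f z - f a) * σ :=
      (hzd.hasDerivWithinAt.mul hl).derivWithin (uniqueDiffWithinAt_Iio a)
    rw [e1, e2] at hle
    linarith
  have hσρ : σ ≤ ρ := le_of_mul_le_mul_left (key y hy) (by linarith)
  have hρσ : ρ ≤ σ := by
    have := key x hx
    nlinarith
  rw [le_antisymm hσρ hρσ] at hl
  exact (hasDerivAt_of_left_right hl hr).differentiableAt

/-- The convex functions for x and y are now differentiable, so their derivatives are continuous;
the difference of these is f y - f x times the derivative of 1 / f'. -/
theorem continuousAt_deriv_inv_of_convexOn (hIo : IsOpen I) (hf : StrictMonoOn f I)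
    (hd : ∀ x ∈ I, HasDerivAt f (f' x) x)
    (hE : ∀ x ∈ I, ConvexOn ℝ I fun a => (f x - f a) / f' a) {a : ℝ} (ha : a ∈ I) :
    ContinuousAt (deriv fun a => (f' a)⁻¹) a := by
  have hdiff := fun b hb => (differentiableAt_inv_of_convexOn hIo hf hd hE (a := b) hb).hasDerivAt
  obtain ⟨x, hx, y, hy, hxa, hay⟩ := exists_lt_mem_lt_mem hIo ha
  have h : f x < f y := (hf hx ha hxa).trans (hf ha hy hay)
  have hc : ∀ z ∈ I, ContinuousAt
      (fun b => -f' b * (f' b)⁻¹ + (f z - f b) * deriv (fun a => (f' a)⁻¹) b) a := fun z hz =>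
    continuousAt_deriv_of_convexOn hIo (hE z hz)
      (fun b hb => ((hd b hb).const_sub (f z)).mul (hdiff b hb)) ha
  have := ((hc y hy).sub (hc x hx)).div_const (f y - f x)
  refine this.congr (Eventually.of_forall fun b => ?_)
  have : f y - f x ≠ 0 := by linarith
  simp only [Pi.sub_apply]
  field_simp
  ring

/-- Concavity of `midTransport I f` forces `f` to be twice continuously differentiable. -/
theorem regularity_of_concaveOn_midTransport (hIo : IsOpen I) (hIc : I.OrdConnected)
    (hf : StrictMonoOn f I) (hfc : ContinuousOn f I)
    (hΨ : ConcaveOn ℝ ((f '' I) ×ˢ (f '' I)) (midTransport I f)) :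
    (∀ x ∈ I, HasDerivAt f (deriv f x) x) ∧ (∀ x ∈ I, 0 < deriv f x) ∧
      (∀ x ∈ I, HasDerivAt (deriv f) (deriv (deriv f) x) x) ∧
        ContinuousOn (deriv (deriv f)) I := by
  have hconv := convexOn_of_concaveOn_midTransport hIc hf hfc hΨ
  have hd : ∀ x ∈ I, HasDerivAt f (deriv f x) x := fun x hx =>
    (differentiableAt_of_concaveOn_midTransport hIo hIc hf hfc hΨ hx).hasDerivAt
  have hpos : ∀ x ∈ I, 0 < deriv f x := fun x hx => deriv_pos_of_convexOn hIo hf hconv hx (hd x hx)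
  have hc1 : ∀ x ∈ I, ContinuousAt (deriv f) x := fun x hx =>
    continuousAt_deriv_of_convexOn hIo hconv hd hx
  have hE : ∀ x ∈ I, ConvexOn ℝ I fun a => (f x - f a) / deriv f a := by
    intro x hx
    refine convexOn_of_midpoint hIc.convex (fun a ha => ?_) fun a ha b hb => ?_
    · exact ((continuousAt_const.sub (hd a ha).continuousAt).div (hc1 a ha)
        (hpos a ha).ne').continuousWithinAt
    -- Both coordinates of the evaluation point equal x, so the tangent inequality becomes midpoint
    -- convexity in the base points a and b.
    · have := tangent_of_concaveOn hIo hIc hf hd hpos hΨ hx hx ha hb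
      rwa [add_self_div_two, ← one_div_mul_eq_div 2 (a + b)] at this
  have hr := fun a ha => (differentiableAt_inv_of_convexOn hIo hf hd hE (a := a) ha).hasDerivAt
  have hd2 : ∀ x ∈ I, HasDerivAt (deriv f)
      (-deriv (fun a => (deriv f a)⁻¹) x / ((deriv f x)⁻¹) ^ 2) x := by
    intro x hx
    have := (hr x hx).inv (inv_ne_zero (hpos x hx).ne')
    rwa [show (fun a => (deriv f a)⁻¹)⁻¹ = deriv f from funext fun a => inv_inv _] at this
  refine ⟨hd, hpos, fun x hx => (hd2 x hx).differentiableAt.hasDerivAt, fun x hx => ?_⟩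
  have h1 : ContinuousAt
      (fun x => -deriv (fun a => (deriv f a)⁻¹) x / ((deriv f x)⁻¹) ^ 2) x :=
    (continuousAt_deriv_inv_of_convexOn hIo hf hd hE hx).neg.div
      (((hc1 x hx).inv₀ (hpos x hx).ne').pow 2)
      (pow_ne_zero 2 (inv_ne_zero (hpos x hx).ne'))
  refine (h1.congr ?_).continuousWithinAt
  filter_upwards [hIo.mem_nhds hx] with y hy using (hd2 y hy).deriv.symm

/-! ### The second-order inequality and concavity of f' / f'' -/

theorem zero_or_pos_of_second_order (hIo : IsOpen I) (hIc : I.OrdConnected)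
    (hpos : ∀ x ∈ I, 0 < f' x) (hc : ContinuousOn f'' I)
    (h : ∀ x ∈ I, ∀ y ∈ I, ∀ P Q : ℝ, f'' ((x + y) / 2) * ((P + Q) / 2) ^ 2 ≤
      f' ((x + y) / 2) * (f'' x / f' x * P ^ 2 + f'' y / f' y * Q ^ 2) / 2) :
    (∀ x ∈ I, f'' x = 0) ∨ ∀ x ∈ I, 0 < f'' x := by
  have hnn : ∀ x ∈ I, 0 ≤ f'' x := by
    intro x hx
    -- Opposite velocities kill the left side, leaving 0 ≤ f'' x.
    have := h x hx x hx 1 (-1)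
    have h0 := hpos x hx
    rw [add_self_div_two] at this
    have e : f' x * (f'' x / f' x * 1 ^ 2 + f'' x / f' x * (-1) ^ 2) / 2 = f'' x := by
      field_simp; norm_num
    rw [e] at this
    simpa using this
  by_cases hz : ∃ x ∈ I, f'' x = 0
  · left
    obtain ⟨x₀, hx₀, hfx₀⟩ := hz
    have hu : IsOpen {x | x ∈ I ∧ f'' x = 0} := by
      rw [isOpen_iff_mem_nhds]
      rintro x ⟨hx, hfx⟩
      have h2 : ∀ᶠ m in 𝓝 x, 2 * m - x ∈ I := by
        have hcont : ContinuousAt (fun m : ℝ => 2 * m - x) x := by fun_prop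
        exact hcont.eventually (hIo.mem_nhds (by simpa [two_mul] using hx))
      filter_upwards [hIo.mem_nhds hx, h2] with m hm hm2
      refine ⟨hm, le_antisymm ?_ (hnn m hm)⟩
      -- With Q = 0 only the term at x survives on the right, and it vanishes. So f'' vanishes at
      -- every m near x, the midpoint of x and 2m - x.
      have := h x hx _ hm2 2 0
      rw [show (x + (2 * m - x)) / 2 = m by ring, hfx] at this
      simpa using this
    have hv : IsOpen (I ∩ f'' ⁻¹' {0}ᶜ) := hc.isOpen_inter_preimage hIo isOpen_compl_singleton
    have hsub := hIc.isPreconnected.subset_left_of_subset_union hu hv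
      (disjoint_left.2 fun x hx hx' => hx'.2 hx.2)
      (fun x hx => (em (f'' x = 0)).imp (fun h => ⟨hx, h⟩) fun h => ⟨hx, h⟩)
      ⟨x₀, hx₀, hx₀, hfx₀⟩
    exact fun x hx => (hsub hx).2
  · push Not at hz
    exact Or.inr fun x hx => (hnn x hx).lt_of_ne' (hz x hx)

theorem concaveOn_ratio_of_second_order (hIc : I.OrdConnected) (hpos : ∀ x ∈ I, 0 < f' x)
    (hc' : ContinuousOn f' I) (hc : ContinuousOn f'' I) (hpos' : ∀ x ∈ I, 0 < f'' x)
    (h : ∀ x ∈ I, ∀ y ∈ I, ∀ P Q : ℝ, f'' ((x + y) / 2) * ((P + Q) / 2) ^ 2 ≤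
      f' ((x + y) / 2) * (f'' x / f' x * P ^ 2 + f'' y / f' y * Q ^ 2) / 2) :
    ConcaveOn ℝ I fun x => f' x / f'' x := by
  refine concaveOn_of_midpoint hIc.convex (hc'.div hc fun x hx => (hpos' x hx).ne') ?_
  intro x hx y hy
  have hm := half_add_mem hIc hx hy
  have hx1 := hpos x hx
  have hx2 := hpos' x hx
  have hy1 := hpos y hy
  have hy2 := hpos' y hy
  -- These velocities are the equality case of Cauchy-Schwarz: both P + Q and the quadratic form
  -- become the sum of the two ratios, and one such factor cancels.
  have key := h x hx y hy (f' x / f'' x) (f' y / f'' y)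
  rw [smul_eq_mul, one_div_mul_eq_div, le_div_iff₀ (hpos' _ hm)]
  have e : f'' x / f' x * (f' x / f'' x) ^ 2 + f'' y / f' y * (f' y / f'' y) ^ 2 =
      f' x / f'' x + f' y / f'' y := by
    field_simp
  rw [e] at key
  have hs : 0 < (f' x / f'' x + f' y / f'' y) / 2 := by positivity
  refine le_of_mul_le_mul_right ?_ hs
  linarith

theorem second_order_of_concaveOn_ratio (hIc : I.OrdConnected) (hpos : ∀ x ∈ I, 0 < f' x)
    (hpos' : ∀ x ∈ I, 0 < f'' x) (h : ConcaveOn ℝ I fun x => f' x / f'' x) {x y : ℝ}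
    (hx : x ∈ I) (hy : y ∈ I) (P Q : ℝ) : f'' ((x + y) / 2) * ((P + Q) / 2) ^ 2 ≤
      f' ((x + y) / 2) * (f'' x / f' x * P ^ 2 + f'' y / f' y * Q ^ 2) / 2 := by
  have hm := half_add_mem hIc hx hy
  have hh := h.2 hx hy one_half_pos.le one_half_pos.le (add_halves 1)
  have em : (1 / 2 : ℝ) • x + (1 / 2 : ℝ) • y = (x + y) / 2 := by simp only [smul_eq_mul]; ring
  rw [em, le_div_iff₀ (hpos' _ hm), smul_eq_mul, smul_eq_mul] at hh
  have ex : f'' x / f' x = (f' x / f'' x)⁻¹ := (inv_div _ _).symm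
  have ey : f'' y / f' y = (f' y / f'' y)⁻¹ := (inv_div _ _).symm
  rw [ex, ey]
  have hA : 0 < f' x / f'' x := div_pos (hpos x hx) (hpos' x hx)
  have hB : 0 < f' y / f'' y := div_pos (hpos y hy) (hpos' y hy)
  have hk := hpos' _ hm
  set A := f' x / f'' x
  set B := f' y / f'' y
  set k := f'' ((x + y) / 2)
  -- Cauchy-Schwarz in Engel form; the concavity hypothesis `hh` bounds k (A + B) / 2 by f' at the
  -- midpoint.
  have hsed : (P + Q) ^ 2 ≤ (A + B) * (A⁻¹ * P ^ 2 + B⁻¹ * Q ^ 2) := by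
    have : (A + B) * (A⁻¹ * P ^ 2 + B⁻¹ * Q ^ 2) - (P + Q) ^ 2 = (P * B - Q * A) ^ 2 / (A * B) := by
      field_simp; ring
    have h2 : 0 ≤ (P * B - Q * A) ^ 2 / (A * B) := by positivity
    linarith
  have hS : 0 ≤ A⁻¹ * P ^ 2 + B⁻¹ * Q ^ 2 := by positivity
  have h1 := mul_le_mul_of_nonneg_right hh hS
  have h2 := mul_le_mul_of_nonneg_left hsed hk.le
  linarith

end QuasiArith

/-! ### Assembling the equivalences -/

theorem mainTheorem5 (I : Set ℝ) (hIo : IsOpen I) (hIc : I.OrdConnected) (hIn : I.Nonempty)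
    (f : ℝ → ℝ) (hf : StrictMonoOn f I) :
    [ -- unweighted Jensen convexity for all `n`
      ∀ n : ℕ, 1 ≤ n → ∀ x y : Fin n → ℝ, (∀ i, x i ∈ I) → (∀ i, y i ∈ I) →
        QuasiArith.genMean I f (fun i => (x i + y i) / 2) ≤
          (1 / 2 : ℝ) * (QuasiArith.genMean I f x + QuasiArith.genMean I f y),
      -- weighted Jensen convexity for all `n`
      ∀ n : ℕ, 1 ≤ n → ∀ x y : Fin n → ℝ, (∀ i, x i ∈ I) → (∀ i, y i ∈ I) →
        ∀ w ∈ QuasiArith.weights n,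
          QuasiArith.genWMean I f (fun i => (x i + y i) / 2) w ≤
            (1 / 2 : ℝ) * (QuasiArith.genWMean I f x w + QuasiArith.genWMean I f y w),
      -- unweighted Jensen convexity for `n = 2`
      ∀ x y : Fin 2 → ℝ, (∀ i, x i ∈ I) → (∀ i, y i ∈ I) →
        QuasiArith.genMean I f (fun i => (x i + y i) / 2) ≤
          (1 / 2 : ℝ) * (QuasiArith.genMean I f x + QuasiArith.genMean I f y),
      -- continuity of `f` and concavity of `Ψ` on `f(I) × f(I)`
      ContinuousOn f I ∧
        ConcaveOn ℝ ((f '' I) ×ˢ (f '' I)) (fun p : ℝ × ℝ =>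
          f ((Function.invFunOn f I p.1 + Function.invFunOn f I p.2) / 2)),
      -- differential characterization
      ContDiffOn ℝ 2 f I ∧ (∀ x ∈ I, 0 < deriv f x) ∧
        ((∀ x ∈ I, deriv (deriv f) x = 0) ∨
          ((∀ x ∈ I, 0 < deriv (deriv f) x) ∧
            ConcaveOn ℝ I (fun x => deriv f x / deriv (deriv f) x)))].TFAE := by
  open QuasiArith in
  tfae_have 2 → 1 := by
    intro h n hn x y hx hy
    -- Unit weights recover the unweighted mean; n ≥ 1 ensures that they are not the zero vector.
    have hw : (fun _ : Fin n => (1 : ℝ)) ∈ weights n :=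
      ⟨fun _ => zero_le_one, fun h0 => one_ne_zero (congrFun h0 ⟨0, hn⟩)⟩
    simpa [genWMean, genMean] using h n hn x y hx hy _ hw
  tfae_have 1 → 3 := fun h => h 2 one_le_two
  tfae_have 3 → 4 := by
    intro h
    have h' : ∀ x₁ ∈ I, ∀ x₂ ∈ I, ∀ y₁ ∈ I, ∀ y₂ ∈ I,
        genInv I f ((f ((x₁ + y₁) / 2) + f ((x₂ + y₂) / 2)) / 2) ≤
          (genInv I f ((f x₁ + f x₂) / 2) + genInv I f ((f y₁ + f y₂) / 2)) / 2 := by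
      intro x₁ hx₁ x₂ hx₂ y₁ hy₁ y₂ hy₂
      have := h ![x₁, x₂] ![y₁, y₂] (Fin.forall_fin_two.2 ⟨hx₁, hx₂⟩)
        (Fin.forall_fin_two.2 ⟨hy₁, hy₂⟩)
      simp only [genMean, Fin.sum_univ_two, Matrix.cons_val_zero, Matrix.cons_val_one,
        Nat.cast_ofNat] at this
      linarith
    have hfc := continuousOn_of_jensen hIo hIc hf h'
    exact ⟨hfc, concaveOn_midTransport_of_jensen hIo hIc hf hfc h'⟩
  tfae_have 4 → 2 := fun h _ _ _ _ hx hy _ hw =>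
    genWMean_jensen_of_concaveOn hIc hf h.1 h.2 hx hy hw
  tfae_have 4 → 5 := by
    rintro ⟨hfc, hΨ⟩
    obtain ⟨hd, hpos, hd2, hc⟩ := regularity_of_concaveOn_midTransport hIo hIc hf hfc hΨ
    have hso := fun x hx y hy => second_order_of_concaveOn hIo hIc hf hd hpos hd2 hΨ
      (x := x) (y := y) hx hy
    refine ⟨?_, hpos, (zero_or_pos_of_second_order hIo hIc hpos hc hso).imp_right fun hp => ⟨hp,
      concaveOn_ratio_of_second_order hIc hpos
        (fun x hx => (hd2 x hx).continuousAt.continuousWithinAt) hc hp hso⟩⟩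
    rw [show (2 : WithTop ℕ∞) = 1 + 1 from one_add_one_eq_two.symm,
      contDiffOn_succ_iff_deriv_of_isOpen hIo]
    refine ⟨fun x hx => (hd x hx).differentiableAt.differentiableWithinAt, by simp, ?_⟩
    rw [show (1 : WithTop ℕ∞) = 0 + 1 from (zero_add 1).symm,
      contDiffOn_succ_iff_deriv_of_isOpen hIo]
    exact ⟨fun x hx => (hd2 x hx).differentiableAt.differentiableWithinAt, by simp,
      contDiffOn_zero.2 hc⟩
  tfae_have 5 → 4 := by
    rintro ⟨hC, hpos, h⟩
    have hd : ∀ x ∈ I, HasDerivAt f (deriv f x) x := fun x hx =>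
      ((hC.differentiableOn two_ne_zero).differentiableAt (hIo.mem_nhds hx)).hasDerivAt
    rw [show (2 : WithTop ℕ∞) = 1 + 1 from one_add_one_eq_two.symm,
      contDiffOn_succ_iff_deriv_of_isOpen hIo] at hC
    have hd2 : ∀ x ∈ I, HasDerivAt (deriv f) (deriv (deriv f) x) x := fun x hx =>
      ((hC.2.2.differentiableOn one_ne_zero).differentiableAt (hIo.mem_nhds hx)).hasDerivAt
    refine ⟨fun x hx => (hd x hx).continuousAt.continuousWithinAt,
      concaveOn_of_second_order hIo hIc hf hd hpos hd2 fun x hx y hy P Q => ?_⟩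
    rcases h with h | ⟨h, h'⟩
    · simp [h x hx, h y hy, h _ (half_add_mem hIc hx hy)]
    · exact second_order_of_concaveOn_ratio hIc hpos h h' hx hy P Q
  tfae_finish
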